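/- Let $\mathcal W=\mathbb C\langle a,a^\dagger\rangle/(aa^\dagger-a^\dagger a-1)$ be the Heisenberg--Weyl algebra. Weyl quantization $:\!\cdot\!:_W$ is the $\mathbb C$-linear map $\mathbb C[\alpha,\alpha^*]\to\mathcal W$ that sends $\alpha^{*n}\alpha^m$ to the average of the $\binom{n+m}{n}$ distinct orderings of a product of $n$ factors $a^\dagger$ and $m$ factors $a$; it is extended coefficientwise to a map $\mathbb C[\alpha,\alpha^*][[\lambda]]\to\mathcal W[[\lambda]]$. Let $L,R\ge 0$ be integers with $e=L+R-1\ge 0$. Define formal power series in $\mathbb C[[D]]$ by $$f(D)=\frac{(1-\frac12D)^{-e}-1}{e}+\frac{(1+\frac12D)^{-e}-1}{-e},\qquad g(D)=\frac12\left[\frac{1+\frac12D}{1-\frac12D}\right]^L+\frac12\left[\frac{1-\frac12D}{1+\frac12D}\right]^R,$$ where for $e=0$ the formula for $f$ is replaced by its formal (coefficientwise) limit as $e\to0$, namely $f(D)=\ln\frac{1+D/2}{1-D/2}$. Then $f$ has a unique compositional inverse $\bar f\in\mathbb C[[z]]$ (a series without constant term such that $f(\bar f(z))=z$ and $\bar f(f(D))=D$).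 It satisfies $\bar f(z)=z+O(z^2)$, the series $\bar g(z)=1/g(\bar f(z))$ satisfies $\bar g(z)=1+O(z)$, and one has the Weyl ordering $$e^{\lambda(a^{\dagger L}\,a\,a^{\dagger R})}\;=\;:\,\bar g(\lambda\alpha^{*e})\,\exp\!\left[(\alpha^*\alpha)\,\bar f(\lambda\alpha^{*e})\right]:_W$$ as an identity in $\mathcal W[[\lambda]]$, where $e^{\lambda G}=\sum_{n\ge0}\lambda^nG^n/n!$ for $G\in\mathcal W$. -/

import Mathlib

noncomputable section

namespace WeylOrdering

open PowerSeries Filter Topology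

/-- The two ladder symbols: the annihilator `a` and the creator `a†`. -/
inductive Ladder : Type
  | ann : Ladder
  | cre : Ladder

/-- The defining relation `a a† = a† a + 1` on the free algebra `ℂ⟨a, a†⟩`. -/
inductive HWRel : FreeAlgebra ℂ Ladder → FreeAlgebra ℂ Ladder → Prop
  | comm : HWRel
      (FreeAlgebra.ι ℂ Ladder.ann * FreeAlgebra.ι ℂ Ladder.cre)
      (FreeAlgebra.ι ℂ Ladder.cre * FreeAlgebra.ι ℂ Ladder.ann + 1)

/-- The Heisenberg-Weyl algebra: the quotient of `ℂ⟨a, a†⟩` by the two-sided ideal generated by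
`a a† - a† a - 1`. -/
abbrev HW : Type := RingQuot HWRel

/-- The annihilator `a`, as an element of the Heisenberg-Weyl algebra. -/
def ann : HW := RingQuot.mkAlgHom ℂ HWRel (FreeAlgebra.ι ℂ Ladder.ann)

/-- The creator `a†`, as an element of the Heisenberg-Weyl algebra. -/
def cre : HW := RingQuot.mkAlgHom ℂ HWRel (FreeAlgebra.ι ℂ Ladder.cre)

theorem ann_mul_cre : ann * cre = cre * ann + 1 := by
  have h := RingQuot.mkAlgHom_rel ℂ HWRel.comm
  rw [map_mul, map_add, map_mul, map_one] at h
  exact h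

/-- The polynomial ring `ℂ[α, α*]` in commuting indeterminates: `α` is `X Ladder.ann` and
`α*` is `X Ladder.cre`. -/
abbrev ClassicalPoly : Type := MvPolynomial Ladder ℂ

/-- The classical (commuting) indeterminate `α`. -/
def alpha : ClassicalPoly := MvPolynomial.X Ladder.ann

/-- The classical (commuting) indeterminate `α*`. -/
def alphaStar : ClassicalPoly := MvPolynomial.X Ladder.cre

/-- The Weyl quantization of `α*ⁿ αᵐ`: the average of the `(n + m).choose n` distinct orderings of
a product of `n` factors `a†` and `m` factors `a`. The ordering that belongs to an `n`-element set
`S` of positions has `a†` at the positions in `S` and `a` at the other ones. -/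
def weylMonomial (n m : ℕ) : HW :=
  (((n + m).choose n : ℕ) : ℂ)⁻¹ •
    ∑ S ∈ Finset.powersetCard n (Finset.univ : Finset (Fin (n + m))),
      (List.ofFn fun i : Fin (n + m) => if i ∈ S then cre else ann).prod

/-- Weyl quantization `:F:_W` of polynomials, extended linearly from monomials. -/
def weylQuant : ClassicalPoly →ₗ[ℂ] HW :=
  (MvPolynomial.basisMonomials Ladder ℂ).constr ℂ
    fun d => weylMonomial (d Ladder.cre) (d Ladder.ann)

/-- Weyl quantization `ℂ[α, α*][[λ]] → W[[λ]]`, acting on each coefficient of a power series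
in `λ`. The variable `X` of these power series is `λ`. -/
def weylQuantSeries (F : ClassicalPoly⟦X⟧) : HW⟦X⟧ :=
  PowerSeries.mk fun n => weylQuant (coeff n F)

/-- `exp (λ G) = ∑ₙ λⁿ Gⁿ / n!` in `W[[λ]]`, for `G` in `W`. -/
def expLambda (G : HW) : HW⟦X⟧ :=
  PowerSeries.mk fun n => ((n.factorial : ℕ) : ℂ)⁻¹ • G ^ n

/-- The series `1 + D / 2`. -/
def onePlusHalf : ℂ⟦X⟧ := 1 + (1 / 2 : ℂ) • X

/-- The series `1 - D / 2`. -/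
def oneMinusHalf : ℂ⟦X⟧ := 1 - (1 / 2 : ℂ) • X

/-- `f(D) = ((1 - D/2)⁻ᵉ - 1) / e + ((1 + D/2)⁻ᵉ - 1) / (-e)` for `e ≠ 0`, and for `e = 0` the
formal limit `log (1 + D/2) - log (1 - D/2)`
(see `weylF_natCast` and `tendsto_coeff_weylFGen`). -/
def weylF (e : ℕ) : ℂ⟦X⟧ :=
  if e = 0 then
    rescale (1 / 2 : ℂ) (PowerSeries.log ℂ) - rescale (-1 / 2 : ℂ) (PowerSeries.log ℂ)
  else
    (e : ℂ)⁻¹ • ((oneMinusHalf ^ e)⁻¹ - 1) + (-(e : ℂ))⁻¹ • ((onePlusHalf ^ e)⁻¹ - 1)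

/-- `g(D) = ½ ((1 + D/2) / (1 - D/2))ᴸ + ½ ((1 - D/2) / (1 + D/2))ᴿ`. -/
def weylG (L R : ℕ) : ℂ⟦X⟧ :=
  (1 / 2 : ℂ) • (onePlusHalf * oneMinusHalf⁻¹) ^ L +
    (1 / 2 : ℂ) • (oneMinusHalf * onePlusHalf⁻¹) ^ R

/-- `h` is the compositional inverse of `f` among the formal power series without constant term:
`f (h (z)) = z` and `h (f (D)) = D`. (`PowerSeries.subst a f` is `f ∘ a`.) -/
structure IsCompInverse (f h : ℂ⟦X⟧) : Prop where
  constantCoeff_left : constantCoeff f = 0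
  constantCoeff_right : constantCoeff h = 0
  comp_right : (PowerSeries.subst h f : ℂ⟦X⟧) = X
  comp_left : (PowerSeries.subst f h : ℂ⟦X⟧) = X

/-- `z = λ (α*)ᵉ` in `ℂ[α, α*][[λ]]`. -/
def zArg (e : ℕ) : ClassicalPoly⟦X⟧ := PowerSeries.C (alphaStar ^ e) * X

/-- `gbar (λ α*ᵉ) · exp [(α* α) fbar (λ α*ᵉ)]` in `ℂ[α, α*][[λ]]`. -/
def classicalForm (e : ℕ) (gbar fbar : ℂ⟦X⟧) : ClassicalPoly⟦X⟧ :=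
  (PowerSeries.subst (zArg e) gbar : ClassicalPoly⟦X⟧) *
    (PowerSeries.subst
      (PowerSeries.C (alphaStar * alpha) * (PowerSeries.subst (zArg e) fbar : ClassicalPoly⟦X⟧))
      (PowerSeries.exp ℂ) : ClassicalPoly⟦X⟧)

/-- `((1 - D/2)^(-ε) - 1) / ε + ((1 + D/2)^(-ε) - 1) / (-ε)` for a complex exponent `ε ≠ 0`, by the
binomial series. -/
def weylFGen (ε : ℂ) : ℂ⟦X⟧ :=
  ε⁻¹ • (rescale (-1 / 2 : ℂ) (binomialSeries ℂ (-ε)) - 1) +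
    (-ε)⁻¹ • (rescale (1 / 2 : ℂ) (binomialSeries ℂ (-ε)) - 1)

theorem rescale_binomialSeries_neg (c : ℂ) (e : ℕ) :
    rescale c (binomialSeries ℂ (-(e : ℂ))) = ((1 + c • X : ℂ⟦X⟧) ^ e)⁻¹ := by
  have h0 : constantCoeff ((1 + c • X : ℂ⟦X⟧) ^ e) ≠ 0 := by simp
  rw [PowerSeries.eq_inv_iff_mul_eq_one h0]
  have h1 : (1 + c • X : ℂ⟦X⟧) ^ e = rescale c (binomialSeries ℂ (e : ℂ)) := by
    rw [binomialSeries_nat, map_pow, map_add, map_one, rescale_X, smul_eq_C_mul]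
  rw [h1, ← map_mul, ← binomialSeries_add, neg_add_cancel, binomialSeries_zero, map_one]

/-- At natural numbers `e ≠ 0` the complex family is `weylF`. -/
theorem weylF_natCast (e : ℕ) (he : e ≠ 0) : weylFGen (e : ℂ) = weylF e := by
  have h1 : (oneMinusHalf : ℂ⟦X⟧) = 1 + (-1 / 2 : ℂ) • X := by
    rw [oneMinusHalf, sub_eq_add_neg, ← neg_smul, neg_div]
  rw [weylFGen, weylF, if_neg he, rescale_binomialSeries_neg, rescale_binomialSeries_neg, h1,
    onePlusHalf]

theorem choose_succ_eq (r : ℂ) (k : ℕ) :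
    Ring.choose r (k + 1) = Ring.choose r k * (r - k) / (k + 1) := by
  have h := Ring.choose_smul_choose r (Nat.le_succ k)
  have h1 : k.succ - k = 1 := by omega
  rw [h1, Ring.choose_one_right, Nat.succ_eq_add_one, Nat.choose_succ_self_right,
    nsmul_eq_mul] at h
  have hk : ((k : ℂ) + 1) ≠ 0 := by exact_mod_cast Nat.succ_ne_zero k
  rw [eq_div_iff hk, ← h]
  push_cast
  ring

theorem tendsto_choose (k : ℕ) :
    Tendsto (fun ε : ℂ => ε⁻¹ * Ring.choose (-ε) (k + 1)) (𝓝[≠] 0)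
      (𝓝 ((-1) ^ (k + 1) / ((k + 1 : ℕ) : ℂ))) := by
  induction k with
  | zero =>
    refine (tendsto_const_nhds (x := (-1 : ℂ))).congr' ?_ |>.trans (le_of_eq (by simp))
    filter_upwards [self_mem_nhdsWithin] with ε hε
    have hε' : ε ≠ 0 := hε
    rw [zero_add, Ring.choose_one_right]
    field_simp
  | succ k ih =>
    have hk : ((k : ℂ) + 1) ≠ 0 := by exact_mod_cast Nat.succ_ne_zero k
    have hk2 : ((k : ℂ) + 1 + 1) ≠ 0 := by exact_mod_cast Nat.succ_ne_zero (k + 1)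
    have h2 : Tendsto (fun ε : ℂ => (-ε - ((k + 1 : ℕ) : ℂ)) / (((k + 1 : ℕ) : ℂ) + 1))
        (𝓝[≠] 0) (𝓝 ((-0 - ((k + 1 : ℕ) : ℂ)) / (((k + 1 : ℕ) : ℂ) + 1))) := by
      apply Tendsto.mono_left _ nhdsWithin_le_nhds
      exact Continuous.tendsto (by fun_prop) 0
    refine ((ih.mul h2).congr ?_).trans (le_of_eq ?_)
    · intro ε
      rw [choose_succ_eq (-ε) (k + 1)]
      ring
    · congr 1
      push_cast
      field_simp
      ring

/-- As `ε → 0`, the complex family converges coefficientwise to `weylF 0`. -/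
theorem tendsto_coeff_weylFGen (n : ℕ) :
    Tendsto (fun ε : ℂ => coeff n (weylFGen ε)) (𝓝[≠] 0) (𝓝 (coeff n (weylF 0))) := by
  rcases n with _ | k
  · have h0 : ∀ ε : ℂ, coeff 0 (weylFGen ε) = coeff 0 (weylF 0) := by
      intro ε
      simp only [weylFGen, weylF, if_true, map_add, map_sub, coeff_smul, coeff_rescale,
        binomialSeries_coeff, coeff_log, Ring.choose_zero_right, coeff_one]
      simp
    simp only [h0]
    exact tendsto_const_nhds
  · have h := (tendsto_choose k).mul_const ((-1 / 2 : ℂ) ^ (k + 1) - (1 / 2) ^ (k + 1))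
    refine (h.congr ?_).trans (le_of_eq ?_)
    · intro ε
      simp only [weylFGen, map_add, map_sub, coeff_smul, coeff_rescale,
        binomialSeries_coeff, coeff_one, Nat.succ_ne_zero, if_false, smul_eq_mul, inv_neg]
      ring
    · congr 1
      simp only [weylF, if_true, map_sub, coeff_rescale, coeff_log, Nat.succ_ne_zero, if_false,
        eq_ratCast]
      push_cast
      have h2 : (-1 / 2 : ℂ) ^ (k + 1) = (-1) ^ (k + 1) * (1 / 2) ^ (k + 1) := by
        rw [← mul_pow]
        norm_num
      have h3 : ((-1 : ℂ) ^ (k + 1)) * (-1) ^ (k + 1) = 1 := by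
        rw [← mul_pow]
        simp
      rw [h2, pow_succ (-1 : ℂ) (k + 1)]
      ring

end WeylOrdering

end

noncomputable section

namespace WeylOrdering

open PowerSeries

/-! Both sides solve the same initial value problem in `λ`. Under Weyl quantization, left
multiplication by `a†` and `a` becomes the action of `α* - ½ ∂/∂α` and `α + ½ ∂/∂α*` on symbols
(`weylQuant_cre`, `weylQuant_ann`). Hence a symbol `F` with `F(0) = 1` and `∂F/∂λ = creOp^L annOp
creOp^R F` quantizes to the exponential (`expLambda_eq_weylQuantSeries`), and only calculus with
commuting variables remains.

Write `y = α*`, `z = λ y^e`, `D = fbar(z)`, `G = 1/g(D)`, `E = exp(αyD)`. On `w E` with `w` free of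
`α`, the operator of `a†` is multiplication by `p = y(1 - D/2)`, so the right side of the evolution
equation for `G E` is `E` times a polynomial of degree one in `α`. The coefficient of `α` gives an
equation for `D`, which follows from `f(D) = z` and the formulas for `f'` and `e f`. The constant
coefficient gives a first-order linear equation for `g`, which the stated `g` solves
(`derivative_weylG_mul`). The comparison is made in `evolution_of_functional_equations`;
`dLambda_classicalForm` supplies its hypotheses. -/

/-! ### Sums over orderings, and Weyl monomials multiplied by `a†` or `a`. -/

/-- The sum of all orderings of a product of `n` factors `a†` and `N - n` factors `a`. -/
def orderingSum (N n : ℕ) : HW :=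
  ∑ S ∈ Finset.powersetCard n (Finset.univ : Finset (Fin N)),
    (List.ofFn fun i : Fin N => if i ∈ S then cre else ann).prod

theorem weylMonomial_eq_smul_orderingSum (n m : ℕ) :
    weylMonomial n m = (((n + m).choose n : ℕ) : ℂ)⁻¹ • orderingSum (n + m) n := rfl

theorem orderingSum_zero_zero : orderingSum 0 0 = 1 := by
  simp [orderingSum]

theorem orderingSum_zero_right (N : ℕ) : orderingSum N 0 = ann ^ N := by
  simp [orderingSum, List.ofFn_const]

theorem orderingSum_of_lt {N n : ℕ} (h : N < n) : orderingSum N n = 0 := by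
  rw [orderingSum, Finset.powersetCard_eq_empty.mpr (by simpa using h), Finset.sum_empty]

theorem prod_ofFn_map_succ (N : ℕ) (S : Finset (Fin N)) :
    (List.ofFn fun i : Fin (N + 1) => if i ∈ S.map (Fin.succEmb N) then cre else ann).prod =
      ann * (List.ofFn fun i : Fin N => if i ∈ S then cre else ann).prod := by
  rw [List.ofFn_succ, List.prod_cons]
  simp [Fin.succ_ne_zero]

theorem prod_ofFn_insert_zero_map_succ (N : ℕ) (S : Finset (Fin N)) :
    (List.ofFn fun i : Fin (N + 1) =>
        if i ∈ insert 0 (S.map (Fin.succEmb N)) then cre else ann).prod =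
      cre * (List.ofFn fun i : Fin N => if i ∈ S then cre else ann).prod := by
  rw [List.ofFn_succ, List.prod_cons]
  simp [Fin.succ_ne_zero]

/-- Pascal's rule for words: sort the sets by whether they contain position `0`, that is, by the
first letter. -/
theorem orderingSum_succ_succ (N n : ℕ) :
    orderingSum (N + 1) (n + 1) = cre * orderingSum N n + ann * orderingSum N (n + 1) := by
  have h0 : (0 : Fin (N + 1)) ∉ (Finset.univ : Finset (Fin N)).map (Fin.succEmb N) := by
    simp [Fin.succ_ne_zero]
  have hu : (Finset.univ : Finset (Fin (N + 1))) =
      insert 0 ((Finset.univ : Finset (Fin N)).map (Fin.succEmb N)) := by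
    ext i
    refine Fin.cases ?_ ?_ i <;> simp
  have hmem : ∀ (k : ℕ), ∀ S ∈ Finset.powersetCard k
      ((Finset.univ : Finset (Fin N)).map (Fin.succEmb N)), (0 : Fin (N + 1)) ∉ S :=
    fun k S hS h => h0 ((Finset.mem_powersetCard.mp hS).1 h)
  rw [orderingSum, hu, Finset.powersetCard_succ_insert h0, Finset.sum_union, Finset.sum_image,
    Finset.powersetCard_map, Finset.powersetCard_map, Finset.sum_map, Finset.sum_map,
    add_comm, orderingSum, orderingSum, Finset.mul_sum, Finset.mul_sum]
  · congr 1
    · exact Finset.sum_congr rfl fun S _ => prod_ofFn_insert_zero_map_succ N S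
    · exact Finset.sum_congr rfl fun S _ => prod_ofFn_map_succ N S
  · intro S hS T hT h
    have hS' := hmem _ S hS
    have hT' := hmem _ T hT
    rw [← Finset.erase_insert hS', ← Finset.erase_insert hT', h]
  · rw [Finset.disjoint_left]
    intro S hS hS'
    obtain ⟨T, _, rfl⟩ := Finset.mem_image.mp hS'
    exact hmem _ _ hS (Finset.mem_insert_self _ _)

theorem orderingSum_succ_zero (N : ℕ) : orderingSum (N + 1) 0 = ann * orderingSum N 0 := by
  rw [orderingSum_zero_right, orderingSum_zero_right, pow_succ']

/-- Symmetrized multiplication by `a†`, moved to the left of all the factors. -/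
theorem succ_smul_orderingSum_succ (N n : ℕ) :
    ((n : ℂ) + 1) • orderingSum (N + 2) (n + 1) =
      ((N : ℂ) + 2) • (cre * orderingSum (N + 1) n) +
        (((N : ℂ) + 1) * (N + 2) / 2) • orderingSum N n := by
  -- Combinatorially, the left side marks one `a†` in each word. Moving it to the front gives the
  -- first term. Each `a` it passes leaves a word with both letters deleted, and the pair can sit in
  -- `(N+2).choose 2` places, whence the second coefficient. The induction splits off the first
  -- letter instead.
  induction N generalizing n with
  | zero =>
    rcases n with _ | _ | n
    · simp [orderingSum_succ_succ, orderingSum_zero_right, orderingSum_of_lt, ann_mul_cre]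
      module
    · simp [orderingSum_succ_succ, orderingSum_zero_right, orderingSum_of_lt]
      module
    · simp [orderingSum_of_lt]
  | succ N ih =>
    have key (x : HW) : ann * (cre * x) = cre * (ann * x) + x := by
      rw [← mul_assoc, ann_mul_cre, add_mul, one_mul, mul_assoc]
    have h2 := congrArg (ann * ·) (ih n)
    simp only [mul_add, mul_smul_comm, key] at h2
    rw [orderingSum_succ_succ (N + 2) n, smul_add, ← mul_smul_comm, mul_smul_comm,
      ← mul_smul_comm _ ann, mul_smul_comm, h2]
    rcases n with _ | n
    · rw [orderingSum_succ_zero (N + 1), orderingSum_succ_zero N]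
      push_cast
      module
    · have h1 := congrArg (cre * ·) (ih n)
      simp only [mul_add, mul_smul_comm] at h1
      have h3 : ((n : ℂ) + 1 + 1) • (cre * orderingSum (N + 2) (n + 1)) =
          ((n : ℂ) + 1) • (cre * orderingSum (N + 2) (n + 1)) +
            cre * orderingSum (N + 2) (n + 1) := by module
      push_cast
      rw [h3, h1, orderingSum_succ_succ (N + 1) n, orderingSum_succ_succ N n]
      simp only [mul_add]
      module

theorem cre_mul_weylMonomial_zero (n : ℕ) :
    cre * weylMonomial n 0 = weylMonomial (n + 1) 0 := by
  have h (k : ℕ) : weylMonomial k 0 = cre ^ k := by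
    induction k with
    | zero => simp [weylMonomial_eq_smul_orderingSum, orderingSum_zero_zero]
    | succ k ih =>
      rw [pow_succ', ← ih]
      simp [weylMonomial_eq_smul_orderingSum, orderingSum_succ_succ, orderingSum_of_lt]
  rw [h, h, pow_succ']

/-- This is `succ_smul_orderingSum_succ` with `N = n + m`, divided by the binomial coefficients. -/
theorem cre_mul_weylMonomial_succ (n m : ℕ) :
    cre * weylMonomial n (m + 1) =
      weylMonomial (n + 1) (m + 1) - (((m : ℂ) + 1) / 2) • weylMonomial n m := by
  have h := succ_smul_orderingSum_succ (n + m) n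
  have e1 : n + 1 + (m + 1) = n + m + 2 := by ring
  have e2 : n + (m + 1) = n + m + 1 := by ring
  have c0 : ((((n + m).choose n : ℕ)) : ℂ) ≠ 0 := by
    exact_mod_cast (Nat.choose_pos (by omega)).ne'
  have d1 : ((n : ℂ) + m + 1) ≠ 0 := by exact_mod_cast Nat.succ_ne_zero (n + m)
  have d2 : ((n : ℂ) + m + 2) ≠ 0 := by exact_mod_cast Nat.succ_ne_zero (n + m + 1)
  have d3 : ((m : ℂ) + 1) ≠ 0 := by exact_mod_cast Nat.succ_ne_zero m
  have d4 : ((n : ℂ) + 1) ≠ 0 := by exact_mod_cast Nat.succ_ne_zero n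
  have c1 : (((n + m + 1).choose n : ℕ) : ℂ) = (n + m + 1) / (m + 1) * (n + m).choose n := by
    have := Nat.add_one_mul_choose_eq (n + m) m
    rw [← Nat.choose_symm_add, ← Nat.choose_symm_of_eq_add (a := n) (b := m + 1) (by ring)] at this
    field_simp
    exact_mod_cast this.symm
  have c2 : (((n + m + 2).choose (n + 1) : ℕ) : ℂ) =
      (n + m + 2) / (n + 1) * (n + m + 1).choose n := by
    have := Nat.add_one_mul_choose_eq (n + m + 1) n
    field_simp
    exact_mod_cast this.symm
  have hs : orderingSum (n + m + 2) (n + 1) = ((n : ℂ) + 1)⁻¹ • (((n : ℂ) + m + 2) •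
      (cre * orderingSum (n + m + 1) n) +
        (((n : ℂ) + m + 1) * (n + m + 2) / 2) • orderingSum (n + m) n) := by
    rw [eq_inv_smul_iff₀ d4, h]
    push_cast
    rfl
  simp only [weylMonomial_eq_smul_orderingSum, e1, e2]
  rw [hs, c2, c1, mul_smul_comm, smul_smul, smul_add, smul_smul, smul_smul, smul_smul]
  rw [eq_sub_iff_add_eq]
  congr 1
  · congr 1
    field_simp
  · congr 1
    field_simp

/-- The truncated `m - 1` is harmless: at `m = 0` its coefficient vanishes. -/
theorem cre_mul_weylMonomial (n m : ℕ) :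
    cre * weylMonomial n m =
      weylMonomial (n + 1) m - ((m : ℂ) / 2) • weylMonomial n (m - 1) := by
  rcases m with _ | m
  · simp [cre_mul_weylMonomial_zero]
  · simpa using cre_mul_weylMonomial_succ n m

/-- No second induction is needed: the first-letter recursion expresses the product with `a` through
the product with `a†`, which is already known. -/
theorem ann_mul_weylMonomial (n m : ℕ) :
    ann * weylMonomial n m =
      weylMonomial n (m + 1) + ((n : ℂ) / 2) • weylMonomial (n - 1) m := by
  rcases n with _ | n
  · simp [weylMonomial_eq_smul_orderingSum, orderingSum_zero_right, pow_succ']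
  · have h := cre_mul_weylMonomial_succ n m
    have d1 : ((n : ℂ) + m + 1) ≠ 0 := by exact_mod_cast Nat.succ_ne_zero (n + m)
    have d2 : ((n : ℂ) + m + 2) ≠ 0 := by exact_mod_cast Nat.succ_ne_zero (n + m + 1)
    have d3 : ((m : ℂ) + 1) ≠ 0 := by exact_mod_cast Nat.succ_ne_zero m
    have d4 : ((n : ℂ) + 1) ≠ 0 := by exact_mod_cast Nat.succ_ne_zero n
    have e1 : n + 1 + (m + 1) = (n + m + 1) + 1 := by ring
    have e2 : n + (m + 1) = n + m + 1 := by ring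
    have e3 : n + 1 + m = n + m + 1 := by ring
    have c0 : (((n + m + 1).choose n : ℕ) : ℂ) ≠ 0 := by
      exact_mod_cast (Nat.choose_pos (by omega)).ne'
    have c1 : (((n + m + 1).choose (n + 1) : ℕ) : ℂ) =
        (m + 1) / (n + 1) * (n + m + 1).choose n := by
      have := Nat.choose_succ_right_eq (n + m + 1) n
      rw [show n + m + 1 - n = m + 1 by omega] at this
      field_simp
      rw [mul_comm ((m : ℂ) + 1)]
      exact_mod_cast this
    have c2 : (((n + m + 2).choose (n + 1) : ℕ) : ℂ) =
        (n + m + 2) / (n + 1) * (n + m + 1).choose n := by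
      have := Nat.add_one_mul_choose_eq (n + m + 1) n
      field_simp
      exact_mod_cast this.symm
    have p := orderingSum_succ_succ (n + m + 1) n
    have w1 : cre * orderingSum (n + m + 1) n = (((n + m + 1).choose n : ℕ) : ℂ) •
        (cre * weylMonomial n (m + 1)) := by
      rw [weylMonomial_eq_smul_orderingSum, mul_smul_comm, smul_smul, e2, mul_inv_cancel₀ c0,
        one_smul]
    have w2 : orderingSum (n + m + 1) (n + 1) = (((n + m + 1).choose (n + 1) : ℕ) : ℂ) •
        weylMonomial (n + 1) m := by
      rw [weylMonomial_eq_smul_orderingSum, smul_smul, e3, mul_inv_cancel₀, one_smul]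
      rw [c1]
      positivity
    have w3 : orderingSum (n + m + 1 + 1) (n + 1) = (((n + m + 2).choose (n + 1) : ℕ) : ℂ) •
        weylMonomial (n + 1) (m + 1) := by
      rw [weylMonomial_eq_smul_orderingSum, smul_smul, e1, mul_inv_cancel₀, one_smul]
      rw [c2]
      positivity
    rw [w1, w2, w3, c1, c2, h, mul_smul_comm] at p
    have hc : ((m : ℂ) + 1) / (n + 1) * (n + m + 1).choose n ≠ 0 := by positivity
    have q : ann * weylMonomial (n + 1) m =
        (((m : ℂ) + 1) / (n + 1) * (n + m + 1).choose n)⁻¹ •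
          ((((n : ℂ) + m + 2) / (n + 1) * (n + m + 1).choose n) • weylMonomial (n + 1) (m + 1) -
            ((n + m + 1).choose n : ℂ) •
              (weylMonomial (n + 1) (m + 1) - (((m : ℂ) + 1) / 2) • weylMonomial n m)) := by
      rw [eq_inv_smul_iff₀ hc, p]
      abel
    rw [q, Nat.add_sub_cancel]
    match_scalars
    · field_simp
      ring
    · field_simp

/-! ### Left multiplication as differential operators on symbols. -/

theorem weylQuant_monomial (d : Ladder →₀ ℕ) (c : ℂ) :
    weylQuant (MvPolynomial.monomial d c) = c • weylMonomial (d Ladder.cre) (d Ladder.ann) := by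
  have h : MvPolynomial.monomial d c = c • MvPolynomial.basisMonomials Ladder ℂ d := by
    rw [MvPolynomial.coe_basisMonomials, MvPolynomial.smul_monomial, smul_eq_mul, mul_one]
  rw [h, map_smul, weylQuant, Module.Basis.constr_basis]

/-- Left multiplication by `a†` in the Weyl symbol calculus: `F ↦ α* F - ½ ∂F/∂α`. -/
theorem weylQuant_cre (F : ClassicalPoly) :
    weylQuant (alphaStar * F - (1 / 2 : ℂ) • MvPolynomial.pderiv Ladder.ann F) =
      cre * weylQuant F := by
  induction F using MvPolynomial.induction_on' with
  | add p q hp hq =>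
    rw [map_add weylQuant, mul_add cre, ← hp, ← hq, ← map_add weylQuant]
    congr 1
    rw [map_add, smul_add, mul_add]
    ring
  | monomial d c =>
    rw [alphaStar, MvPolynomial.X, MvPolynomial.monomial_mul, MvPolynomial.pderiv_monomial,
      map_sub, map_smul, weylQuant_monomial, weylQuant_monomial, weylQuant_monomial,
      mul_smul_comm, cre_mul_weylMonomial]
    have h1 : (Finsupp.single Ladder.cre 1 + d : Ladder →₀ ℕ) Ladder.cre = d Ladder.cre + 1 := by
      simp [add_comm]
    have h2 : (Finsupp.single Ladder.cre 1 + d : Ladder →₀ ℕ) Ladder.ann = d Ladder.ann := by simp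
    have h3 : (d - Finsupp.single Ladder.ann 1 : Ladder →₀ ℕ) Ladder.cre = d Ladder.cre := by simp
    have h4 : (d - Finsupp.single Ladder.ann 1 : Ladder →₀ ℕ) Ladder.ann = d Ladder.ann - 1 := by simp
    rw [h1, h2, h3, h4]
    module

/-- Left multiplication by `a` in the Weyl symbol calculus: `F ↦ α F + ½ ∂F/∂α*`. -/
theorem weylQuant_ann (F : ClassicalPoly) :
    weylQuant (alpha * F + (1 / 2 : ℂ) • MvPolynomial.pderiv Ladder.cre F) =
      ann * weylQuant F := by
  induction F using MvPolynomial.induction_on' with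
  | add p q hp hq =>
    rw [map_add weylQuant p q, mul_add ann, ← hp, ← hq, ← map_add weylQuant]
    congr 1
    rw [map_add, smul_add, mul_add]
    ring
  | monomial d c =>
    rw [alpha, MvPolynomial.X, MvPolynomial.monomial_mul, MvPolynomial.pderiv_monomial,
      map_add, map_smul, weylQuant_monomial, weylQuant_monomial, weylQuant_monomial,
      mul_smul_comm, ann_mul_weylMonomial]
    have h1 : (Finsupp.single Ladder.ann 1 + d : Ladder →₀ ℕ) Ladder.ann = d Ladder.ann + 1 := by
      simp [add_comm]
    have h2 : (Finsupp.single Ladder.ann 1 + d : Ladder →₀ ℕ) Ladder.cre = d Ladder.cre := by simp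
    have h3 : (d - Finsupp.single Ladder.cre 1 : Ladder →₀ ℕ) Ladder.ann = d Ladder.ann := by simp
    have h4 : (d - Finsupp.single Ladder.cre 1 : Ladder →₀ ℕ) Ladder.cre = d Ladder.cre - 1 := by simp
    rw [h1, h2, h3, h4]
    module

/-! ### Derivations of power series rings and the chain rule. -/

section Derivations

variable {A B : Type*} [CommRing A] [CommRing B] [Algebra A B]

/-- A derivation of `B`, extended coefficientwise to a derivation of `B⟦X⟧`. -/
def coeffDerivation (D : Derivation A B B) : Derivation A B⟦X⟧ B⟦X⟧ :=
  Derivation.mk'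
    { toFun := fun F => PowerSeries.mk fun n => D (coeff n F)
      map_add' := fun F G => by ext n; simp
      map_smul' := fun c F => by ext n; simp }
    (fun F G => by
      ext n
      simp only [LinearMap.coe_mk, AddHom.coe_mk, coeff_mk, coeff_mul, map_sum,
        Derivation.leibniz, smul_eq_mul, map_add, Finset.sum_add_distrib]
      congr 1
      rw [← Finset.Nat.sum_antidiagonal_swap]
      rfl)

theorem coeff_coeffDerivation (D : Derivation A B B) (F : B⟦X⟧) (n : ℕ) :
    coeff n (coeffDerivation D F) = D (coeff n F) := by
  simp [coeffDerivation]

theorem coeffDerivation_C (D : Derivation A B B) (b : B) :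
    coeffDerivation D (C b) = C (D b) := by
  ext n
  rw [coeff_coeffDerivation, coeff_C, coeff_C]
  split_ifs <;> simp

theorem coeffDerivation_X (D : Derivation A B B) :
    coeffDerivation D X = 0 := by
  ext n
  rw [coeff_coeffDerivation, coeff_X]
  split_ifs <;> simp

/-- The chain rule for substitution into a power series, for an arbitrary derivation. -/
theorem derivation_subst (D : Derivation A B⟦X⟧ B⟦X⟧) {a : B⟦X⟧} (ha : constantCoeff a = 0)
    (f : A⟦X⟧) :
    D (subst a f : B⟦X⟧) = (subst a (d⁄dX A f) : B⟦X⟧) * D a := by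
  have hs : HasSubst a := HasSubst.of_constantCoeff_zero' ha
  -- No continuity of `D` is assumed, so the defect is shown to lie in every power of `(X)`. Split
  -- `f` into a truncation, where the chain rule is the polynomial one, and a multiple of `X ^ (n +
  -- 1)`, whose defect keeps the factor `a ^ (n + 1)`.
  suffices h : ∀ n : ℕ, X ^ (n + 1) ∣ D (subst a f : B⟦X⟧) - (subst a (d⁄dX A f) : B⟦X⟧) * D a by
    rw [← sub_eq_zero]
    ext n
    exact X_pow_dvd_iff.mp (h n) n (Nat.lt_succ_self n)
  intro n
  obtain ⟨g, hg⟩ : ∃ g, f = X ^ (n + 1) * g + (trunc (n + 1) f : A⟦X⟧) :=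
    ⟨_, eq_X_pow_mul_shift_add_trunc (n + 1) f⟩
  set t := trunc (n + 1) f
  have h1 : (subst a f : B⟦X⟧) =
      a ^ (n + 1) * (subst a g : B⟦X⟧) + Polynomial.aeval a t := by
    rw [hg, subst_add hs, subst_mul hs, subst_pow hs, subst_X hs, subst_coe hs]
  have h2 : d⁄dX A f = X ^ (n + 1) * d⁄dX A g + ((n + 1 : ℕ) : A⟦X⟧) * (X ^ n * g) +
      ((Polynomial.derivative t : Polynomial A) : A⟦X⟧) := by
    rw [hg, map_add, derivative_coe, Derivation.leibniz, Derivation.leibniz_pow, derivative_X]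
    simp only [smul_eq_mul, nsmul_eq_mul, Nat.add_sub_cancel]
    ring
  have h3 : (subst a (d⁄dX A f) : B⟦X⟧) =
      a ^ (n + 1) * (subst a (d⁄dX A g) : B⟦X⟧) +
        ((n + 1 : ℕ) : B⟦X⟧) * (a ^ n * (subst a g : B⟦X⟧)) +
        Polynomial.aeval a (Polynomial.derivative t) := by
    have h4 : (subst a (((n + 1 : ℕ) : A⟦X⟧)) : B⟦X⟧) = ((n + 1 : ℕ) : B⟦X⟧) := by
      rw [← coe_substAlgHom hs, map_natCast]
    rw [h2, subst_add hs, subst_add hs, subst_mul hs, subst_mul hs, subst_mul hs, subst_pow hs,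
      subst_pow hs, subst_X hs, subst_coe hs, h4]
  have h5 : D (subst a f : B⟦X⟧) - (subst a (d⁄dX A f) : B⟦X⟧) * D a =
      a ^ (n + 1) * (D (subst a g : B⟦X⟧) - (subst a (d⁄dX A g) : B⟦X⟧) * D a) := by
    rw [h1, h3, map_add, Derivation.map_aeval, Derivation.leibniz, Derivation.leibniz_pow]
    simp only [smul_eq_mul, nsmul_eq_mul, Nat.add_sub_cancel]
    ring
  rw [h5]
  exact Dvd.dvd.mul_right (pow_dvd_pow_of_dvd (X_dvd_iff.mpr ha) _) _

end Derivations

/-! ### From the evolution equation of symbols to the exponential. -/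

/-- The operator `α* - ½ ∂/∂α` on `ℂ[α, α*][[λ]]`. -/
def creOp (F : ClassicalPoly⟦X⟧) : ClassicalPoly⟦X⟧ :=
  C alphaStar * F - (1 / 2 : ℂ) • coeffDerivation (MvPolynomial.pderiv Ladder.ann) F

/-- The operator `α + ½ ∂/∂α*` on `ℂ[α, α*][[λ]]`. -/
def annOp (F : ClassicalPoly⟦X⟧) : ClassicalPoly⟦X⟧ :=
  C alpha * F + (1 / 2 : ℂ) • coeffDerivation (MvPolynomial.pderiv Ladder.cre) F

theorem weylQuant_coeff_creOp (F : ClassicalPoly⟦X⟧) (n : ℕ) :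
    weylQuant (coeff n (creOp F)) = cre * weylQuant (coeff n F) := by
  rw [← weylQuant_cre, creOp, map_sub, coeff_C_mul, coeff_smul, coeff_coeffDerivation]

theorem weylQuant_coeff_annOp (F : ClassicalPoly⟦X⟧) (n : ℕ) :
    weylQuant (coeff n (annOp F)) = ann * weylQuant (coeff n F) := by
  rw [← weylQuant_ann, annOp, map_add, coeff_C_mul, coeff_smul, coeff_coeffDerivation]

theorem weylQuant_coeff_creOp_iterate (F : ClassicalPoly⟦X⟧) (n k : ℕ) :
    weylQuant (coeff n (creOp^[k] F)) = cre ^ k * weylQuant (coeff n F) := by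
  induction k with
  | zero => simp
  | succ k ih => rw [Function.iterate_succ_apply', weylQuant_coeff_creOp, ih, pow_succ', mul_assoc]

/-- A classical power series that solves the evolution equation with initial value `1`
quantizes to the exponential. -/
theorem expLambda_eq_weylQuantSeries (L R : ℕ) (F : ClassicalPoly⟦X⟧)
    (h0 : constantCoeff F = 1)
    (hF : d⁄dX ClassicalPoly F = creOp^[L] (annOp (creOp^[R] F))) :
    expLambda (cre ^ L * ann * cre ^ R) = weylQuantSeries F := by
  ext n
  rw [expLambda, weylQuantSeries, coeff_mk, coeff_mk]
  induction n with
  | zero =>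
    rw [coeff_zero_eq_constantCoeff_apply, h0, ← MvPolynomial.C_1, ← MvPolynomial.monomial_zero',
      weylQuant_monomial]
    simp [weylMonomial]
  | succ n ih =>
    -- The coefficient of `λ^n` reads `(n + 1) W_{n+1} = (a†^L a a†^R) W_n` for the quantized
    -- coefficients `W_n`: the recursion of the exponential series.
    have h := congrArg (fun G => weylQuant (coeff n G)) hF
    simp only [coeff_derivative, weylQuant_coeff_creOp_iterate, weylQuant_coeff_annOp, ← ih] at h
    have hn : ((n : ℂ) + 1) ≠ 0 := by exact_mod_cast Nat.succ_ne_zero n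
    have h1 : coeff (n + 1) F * ((n : ClassicalPoly) + 1) = ((n : ℂ) + 1) • coeff (n + 1) F := by
      rw [MvPolynomial.smul_eq_C_mul, mul_comm]
      simp
    rw [h1, map_smul] at h
    apply smul_right_injective HW hn
    simp only [h, mul_smul_comm, smul_smul, pow_succ', mul_assoc, Nat.factorial_succ]
    congr 1
    push_cast
    field_simp

/-! ### The evolution equation in an abstract differential ring. -/

section SymbolCalculus

-- Intended reading: `y = α*`, `κ = 1/2`, `D = fbar(λ y^e)`, `E = exp(αyD)`, and `dα`, `dy`, `dl`
-- are the partial derivatives in `α`, `α*`, `λ`.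
variable {A : Type*} [CommRing A] [Algebra ℂ A] {dα dy dl : Derivation ℂ A A}
  {y α κ D E w : A}

/-- Since `∂E/∂α = yDE` and `w` is free of `α`, each application multiplies by `y(1 - κD)`. -/
theorem iterate_mul_sub_exp (hy : dα y = 0) (hκ : dα κ = 0) (hD : dα D = 0)
    (hE : dα E = y * D * E) (hw : dα w = 0) (k : ℕ) :
    (fun F => y * F - κ * dα F)^[k] (w * E) = (y * (1 - κ * D)) ^ k * w * E := by
  induction k with
  | zero => simp
  | succ k ih =>
    rw [Function.iterate_succ_apply', ih]
    simp only [Derivation.leibniz, Derivation.leibniz_pow, map_sub, Derivation.map_one_eq_zero,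
      hy, hκ, hD, hE, hw, smul_eq_mul, nsmul_eq_mul]
    ring

/-- The extra factor `α` is differentiated once in each of the `k` steps, which adds the term with
`-κk`; the truncated exponent at `k = 0` has coefficient `0`. -/
theorem iterate_mul_sub_linear_exp (hy : dα y = 0) (hα : dα α = 1) (hκ : dα κ = 0)
    (hD : dα D = 0) (hE : dα E = y * D * E) (hw : dα w = 0) (k : ℕ) :
    (fun F => y * F - κ * dα F)^[k] (α * w * E) =
      (α * (y * (1 - κ * D)) ^ k - κ * k * (y * (1 - κ * D)) ^ (k - 1)) * w * E := by
  induction k with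
  | zero => simp
  | succ k ih =>
    rw [Function.iterate_succ_apply', ih]
    simp only [Derivation.leibniz, Derivation.leibniz_pow, map_sub, Derivation.map_one_eq_zero,
      Derivation.map_natCast, hy, hα, hκ, hD, hE, hw, smul_eq_mul, nsmul_eq_mul,
      Nat.add_sub_cancel]
    rcases k with _ | k
    · simp
      ring
    · simp only [Nat.add_sub_cancel]
      push_cast
      ring

/-- The evolution equation of `g⁻¹ exp (α y D)`, reduced to the differential equations
for the functions `f` and `g` of `D`. -/
theorem evolution_of_functional_equations [IsDomain A] {L R e : ℕ} (he : L + R = e + 1)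
    {f₀ f₁ g₀ g₁ G Q B : A}
    (hcomm : ∀ F, dα (dy F) = dy (dα F))
    (hαy : dα y = 0) (hαα : dα α = 1) (hακ : dα κ = 0) (hαD : dα D = 0)
    (hyy : dy y = 1) (hyα : dy α = 0) (hyκ : dy κ = 0) (hly : dl y = 0) (hlα : dl α = 0)
    (hκ : 2 * κ = 1) (hy0 : y ≠ 0) (hf0 : f₁ ≠ 0)
    (hlD : f₁ * dl D = y ^ e) (hyD : y * (f₁ * dy D) = e * f₀)
    (hQ : (1 - κ * D) * Q = 1) (hB : (1 + κ * D) * B = 1)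
    (hf₁ : 2 * f₁ = Q ^ (e + 1) + B ^ (e + 1)) (hf₀ : e * f₀ = Q ^ e - B ^ e)
    (hg : g₁ * ((1 + κ * D) * Q ^ e + (1 - κ * D) * B ^ e) =
      g₀ * (L * Q ^ (e + 1) - R * B ^ (e + 1)))
    (hG : g₀ * G = 1)
    (hαG : dα G = -G ^ 2 * g₁ * dα D) (hyG : dy G = -G ^ 2 * g₁ * dy D)
    (hlG : dl G = -G ^ 2 * g₁ * dl D)
    (hαE : dα E = dα (y * α * D) * E) (hyE : dy E = dy (y * α * D) * E)
    (hlE : dl E = dl (y * α * D) * E) :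
    dl (G * E) = (fun F => y * F - κ * dα F)^[L]
      ((fun F => α * F + κ * dy F) ((fun F => y * F - κ * dα F)^[R] (G * E))) := by
  have h2 : (2 : A) ≠ 0 := fun h => by simp [h] at hκ
  have hQ0 : (1 - κ * D) ≠ 0 := left_ne_zero_of_mul_eq_one hQ
  have hαE' : dα E = y * D * E := by
    rw [hαE]
    simp only [Derivation.leibniz, hαy, hαα, hαD, smul_eq_mul]
    ring
  have hαG' : dα G = 0 := by rw [hαG, hαD, mul_zero]
  set q := 1 - κ * D with hq
  set p := y * q with hp
  set h := p ^ R * G with hh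
  set v := 1 + κ * (D + y * dy D) with hv
  have hαh : dα h = 0 := by
    simp [hh, hp, hq, Derivation.leibniz, Derivation.leibniz_pow, hαy, hακ, hαD, hαG']
  have hαyh : dα (dy h) = 0 := by rw [hcomm, hαh, map_zero]
  have hαv : dα v = 0 := by
    simp [hv, Derivation.leibniz, hαy, hακ, hαD, hcomm]
  have hαhv : dα (h * v) = 0 := by simp [Derivation.leibniz, hαh, hαv]
  have hακh : dα (κ * dy h) = 0 := by simp [Derivation.leibniz, hακ, hαyh]
  have hadd : ∀ (k : ℕ) (F F' : A), (fun F => y * F - κ * dα F)^[k] (F + F') =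
      (fun F => y * F - κ * dα F)^[k] F + (fun F => y * F - κ * dα F)^[k] F' := by
    intro k
    induction k with
    | zero => simp
    | succ k ih =>
      intro F F'
      rw [Function.iterate_succ_apply, Function.iterate_succ_apply, Function.iterate_succ_apply,
        ← ih]
      congr 1
      simp only [map_add]
      ring
  -- The `α*`-derivative of `E` contributes `α(D + y ∂D/∂y)`, so the middle operator raises the
  -- degree in `α` to one, with leading coefficient `h v`.
  have hmid : (fun F => α * F + κ * dy F) (h * E) = α * (h * v) * E + (κ * dy h) * E := by
    simp only [Derivation.leibniz, hyE, hyy, hyα, smul_eq_mul, hv]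
    ring
  rw [iterate_mul_sub_exp hαy hακ hαD hαE' hαG', ← hq, ← hp, ← hh, hmid, hadd,
    iterate_mul_sub_linear_exp hαy hαα hακ hαD hαE' hαhv,
    iterate_mul_sub_exp hαy hακ hαD hαE' hακh, ← hq, ← hp]
  have hb : 1 + κ * D = 2 - q := by rw [hq]; ring
  rw [hb] at hB hg
  have hQe : Q ^ e = q * Q ^ (e + 1) := by rw [pow_succ]; linear_combination (-Q ^ e) * hQ
  have hBe : B ^ e = (2 - q) * B ^ (e + 1) := by rw [pow_succ]; linear_combination (-B ^ e) * hB
  have hκD : κ * D = 1 - q := by rw [hq]; ring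
  have hfv : f₁ * v = Q ^ (e + 1) := by
    apply mul_left_cancel₀ h2
    have h1 : 2 * (f₁ * v) = 2 * f₁ * (1 + κ * D) + 2 * κ * (y * (f₁ * dy D)) := by
      rw [hv]; ring
    rw [h1, hyD, hf₀, hκ, hf₁, hκD, hQe, hBe]
    ring
  have hfp : f₁ * dy p = B ^ (e + 1) := by
    apply mul_left_cancel₀ h2
    have h1 : 2 * (f₁ * dy p) = 2 * f₁ * q - 2 * κ * (y * (f₁ * dy D)) := by
      simp only [hp, hq, Derivation.leibniz, map_sub, Derivation.map_one_eq_zero, hyy, hyκ,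
        smul_eq_mul]
      ring
    rw [h1, hyD, hf₀, hκ, hf₁, hQe, hBe]
    ring
  have hpQ : p ^ (e + 1) * Q ^ (e + 1) = y ^ (e + 1) := by
    rw [← mul_pow, hp, mul_assoc, hQ, mul_one]
  -- Coefficient of `α` in the evolution equation.
  have hlin : y * dl D = p ^ (e + 1) * v := by
    apply mul_left_cancel₀ hf0
    have h1 : f₁ * (y * dl D) = y * (f₁ * dl D) := by ring
    have h3 : f₁ * (p ^ (e + 1) * v) = p ^ (e + 1) * (f₁ * v) := by ring
    rw [h1, h3, hlD, hfv, hpQ, pow_succ']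
  have hp0 : p ≠ 0 := mul_ne_zero hy0 hQ0
  have hpL : p * (L * p ^ (L - 1)) = L * p ^ L := by
    rcases L with _ | L
    · simp
    · rw [Nat.add_sub_cancel, pow_succ]
      ring
  have hph : p * dy h = R * p ^ R * dy p * G - p ^ (R + 1) * G ^ 2 * g₁ * dy D := by
    have hpR : p * (R * p ^ (R - 1)) = R * p ^ R := by
      rcases R with _ | R
      · simp
      · rw [Nat.add_sub_cancel, pow_succ]
        ring
    simp only [hh, Derivation.leibniz, Derivation.leibniz_pow, hyG, smul_eq_mul, nsmul_eq_mul]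
    linear_combination (G * dy p) * hpR
  have hpe : p ^ L * p ^ R = p ^ (e + 1) := by rw [← pow_add, he]
  have hGg : G * (L * Q ^ (e + 1) - R * B ^ (e + 1)) =
      G ^ 2 * g₁ * ((2 - q) * Q ^ e + q * B ^ e) := by
    linear_combination (-G ^ 2) * hg - G * (L * Q ^ (e + 1) - R * B ^ (e + 1)) * hG
  have hpD : p * (f₁ * dy D) = q * (Q ^ e - B ^ e) := by
    rw [hp, ← hf₀, ← hyD]
    ring
  -- Coefficient of `α^0`. After multiplication by `2 p f₁` all derivatives of `D` are eliminated
  -- and the equation `hg` for `g` is what remains.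
  have hconst : dl G = κ * p ^ L * dy h - κ * L * p ^ (L - 1) * (h * v) := by
    apply mul_left_cancel₀ (mul_ne_zero (mul_ne_zero h2 hp0) hf0)
    have h1 : 2 * p * f₁ * dl G = -2 * p * G ^ 2 * g₁ * y ^ e := by
      rw [hlG, ← hlD]
      ring
    have h3 : 2 * p * f₁ * (κ * p ^ L * dy h - κ * L * p ^ (L - 1) * (h * v)) =
        (2 * κ) * f₁ * (p ^ L * (p * dy h) - p * (L * p ^ (L - 1)) * (h * v)) := by
      ring
    have h4 : f₁ * (p ^ L * (R * p ^ R * dy p * G - p ^ (R + 1) * G ^ 2 * g₁ * dy D) -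
          L * p ^ L * (p ^ R * G * v)) =
        (p ^ L * p ^ R) * (R * (f₁ * dy p) * G - G ^ 2 * g₁ * (p * (f₁ * dy D)) -
          L * G * (f₁ * v)) := by
      ring
    rw [h1, h3, hκ, one_mul, hpL, hph, hh, h4, hpe, hfp, hpD, hfv]
    have h5 : p * y ^ e = p ^ (e + 1) * Q ^ e := by
      have h6 : p ^ e * Q ^ e = y ^ e := by rw [← mul_pow, hp, mul_assoc, hQ, mul_one]
      rw [pow_succ']
      linear_combination (-p) * h6
    linear_combination (-2 * G ^ 2 * g₁) * h5 + p ^ (e + 1) * hGg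
  have hfin : dl (G * E) = (dl G + α * G * (y * dl D)) * E := by
    simp only [Derivation.leibniz, hlE, hly, hlα, smul_eq_mul]
    ring
  rw [hfin, hlin, hconst, ← hpe, hh]
  ring

end SymbolCalculus

/-! ### Differential equations of the series `f` and `g`. -/

theorem constantCoeff_onePlusHalf : constantCoeff onePlusHalf = 1 := by simp [onePlusHalf]

theorem constantCoeff_oneMinusHalf : constantCoeff oneMinusHalf = 1 := by simp [oneMinusHalf]

theorem onePlusHalf_mul_inv : onePlusHalf * onePlusHalf⁻¹ = 1 :=
  PowerSeries.mul_inv_cancel _ (by simp [constantCoeff_onePlusHalf])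

theorem oneMinusHalf_mul_inv : oneMinusHalf * oneMinusHalf⁻¹ = 1 :=
  PowerSeries.mul_inv_cancel _ (by simp [constantCoeff_oneMinusHalf])

theorem C_half_add_C_half : (C (1 / 2 : ℂ) + C (1 / 2 : ℂ) : ℂ⟦X⟧) = 1 := by
  rw [← map_add, ← map_one (C (R := ℂ))]
  norm_num

theorem onePlusHalf_eq : onePlusHalf = 1 + C (1 / 2 : ℂ) * X := by
  rw [onePlusHalf, smul_eq_C_mul]

theorem oneMinusHalf_eq : oneMinusHalf = 1 - C (1 / 2 : ℂ) * X := by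
  rw [oneMinusHalf, smul_eq_C_mul]

theorem onePlusHalf_add_oneMinusHalf : onePlusHalf + oneMinusHalf = 2 := by
  rw [onePlusHalf_eq, oneMinusHalf_eq]
  ring

theorem derivative_onePlusHalf : d⁄dX ℂ onePlusHalf = C (1 / 2) := by
  rw [onePlusHalf_eq]
  simp [Derivation.leibniz]

theorem derivative_oneMinusHalf : d⁄dX ℂ oneMinusHalf = -C (1 / 2) := by
  rw [oneMinusHalf_eq]
  simp [Derivation.leibniz]

theorem pow_inv_eq_inv_pow {u : ℂ⟦X⟧} (hu : constantCoeff u = 1) (n : ℕ) :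
    (u ^ n)⁻¹ = u⁻¹ ^ n := by
  rw [eq_comm, PowerSeries.eq_inv_iff_mul_eq_one (by simp [hu]), ← mul_pow, mul_comm,
    PowerSeries.mul_inv_cancel _ (by simp [hu]), one_pow]

theorem derivative_rescale_log_mul (c : ℂ) :
    d⁄dX ℂ (rescale c (PowerSeries.log ℂ)) * (1 + C c * X) = C c := by
  have h (n : ℕ) : coeff n (d⁄dX ℂ (rescale c (PowerSeries.log ℂ))) = c ^ (n + 1) * (-1) ^ n := by
    have hn : ((n : ℂ) + 1) ≠ 0 := by exact_mod_cast Nat.succ_ne_zero n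
    rw [coeff_derivative, coeff_rescale, coeff_log, if_neg (Nat.succ_ne_zero n)]
    simp only [eq_ratCast]
    push_cast
    field_simp
    ring
  ext n
  rw [mul_add, mul_one, ← mul_assoc, map_add]
  rcases n with _ | n
  · simp [h]
  · rw [coeff_succ_mul_X, coeff_mul_C, h, h, coeff_C, if_neg (Nat.succ_ne_zero n)]
    ring

/-- This form also holds for the logarithm at `e = 0`, so later arguments need no case distinction.
-/
theorem two_mul_derivative_weylF (e : ℕ) :
    2 * d⁄dX ℂ (weylF e) = oneMinusHalf⁻¹ ^ (e + 1) + onePlusHalf⁻¹ ^ (e + 1) := by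
  have hc := C_half_add_C_half
  rcases Nat.eq_zero_or_pos e with rfl | he
  · have h1 := derivative_rescale_log_mul (1 / 2)
    have h2 := derivative_rescale_log_mul (-1 / 2)
    have hm : (1 + C (-1 / 2 : ℂ) * X : ℂ⟦X⟧) = oneMinusHalf := by
      rw [oneMinusHalf_eq, neg_div, map_neg]
      ring
    rw [← onePlusHalf_eq] at h1
    rw [hm, neg_div, map_neg] at h2
    rw [weylF, if_pos rfl, map_sub, neg_div, zero_add, pow_one, pow_one]
    linear_combination 2 * onePlusHalf⁻¹ * h1 - 2 * oneMinusHalf⁻¹ * h2 +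
      (onePlusHalf⁻¹ + oneMinusHalf⁻¹) * hc
      - 2 * d⁄dX ℂ (rescale (1 / 2 : ℂ) (PowerSeries.log ℂ)) * onePlusHalf_mul_inv
      + 2 * d⁄dX ℂ (rescale (-(1 / 2) : ℂ) (PowerSeries.log ℂ)) * oneMinusHalf_mul_inv
  · obtain ⟨k, rfl⟩ := Nat.exists_eq_add_of_le' he
    have hk : ((k : ℂ) + 1) ≠ 0 := by exact_mod_cast Nat.succ_ne_zero k
    have hk' : C ((k : ℂ) + 1)⁻¹ * ((k : ℂ⟦X⟧) + 1) = 1 := by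
      have : ((k : ℂ⟦X⟧) + 1) = C ((k : ℂ) + 1) := by simp
      rw [this, ← map_mul, inv_mul_cancel₀ hk, map_one]
    rw [weylF, if_neg (Nat.succ_ne_zero k), pow_inv_eq_inv_pow constantCoeff_oneMinusHalf,
      pow_inv_eq_inv_pow constantCoeff_onePlusHalf]
    simp only [smul_eq_C_mul, map_add, map_sub, Derivation.leibniz, Derivation.leibniz_pow,
      derivative_C, derivative_inv', derivative_onePlusHalf, derivative_oneMinusHalf,
      smul_eq_mul, nsmul_eq_mul, Derivation.map_one_eq_zero, Nat.add_sub_cancel, inv_neg, map_neg]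
    push_cast
    linear_combination (2 * C (1 / 2) * (oneMinusHalf⁻¹ ^ (k + 2) + onePlusHalf⁻¹ ^ (k + 2))) * hk'
      + (oneMinusHalf⁻¹ ^ (k + 2) + onePlusHalf⁻¹ ^ (k + 2)) * hc

theorem natCast_mul_weylF (e : ℕ) :
    (e : ℂ⟦X⟧) * weylF e = oneMinusHalf⁻¹ ^ e - onePlusHalf⁻¹ ^ e := by
  rcases Nat.eq_zero_or_pos e with rfl | he
  · simp
  · have hk : (e : ℂ) ≠ 0 := by exact_mod_cast he.ne'
    have hk' : (e : ℂ⟦X⟧) * C (e : ℂ)⁻¹ = 1 := by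
      have : (e : ℂ⟦X⟧) = C (e : ℂ) := by simp
      rw [this, ← map_mul, mul_inv_cancel₀ hk, map_one]
    rw [weylF, if_neg he.ne', pow_inv_eq_inv_pow constantCoeff_oneMinusHalf,
      pow_inv_eq_inv_pow constantCoeff_onePlusHalf]
    simp only [smul_eq_C_mul, inv_neg, map_neg]
    linear_combination (oneMinusHalf⁻¹ ^ e - onePlusHalf⁻¹ ^ e) * hk'

theorem constantCoeff_weylF (e : ℕ) : constantCoeff (weylF e) = 0 := by
  rw [weylF]
  split_ifs with h
  · rw [map_sub, ← coeff_zero_eq_constantCoeff_apply, ← coeff_zero_eq_constantCoeff_apply,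
      coeff_rescale, coeff_rescale]
    simp
  · simp [constantCoeff_onePlusHalf, constantCoeff_oneMinusHalf]

theorem coeff_one_weylF (e : ℕ) : coeff 1 (weylF e) = 1 := by
  have h := congrArg constantCoeff (two_mul_derivative_weylF e)
  rw [← coeff_zero_eq_constantCoeff_apply, ← coeff_zero_eq_constantCoeff_apply,
    ← map_ofNat (C (R := ℂ)) 2, coeff_C_mul, coeff_derivative] at h
  simp [constantCoeff_onePlusHalf, constantCoeff_oneMinusHalf] at h
  linear_combination h / 2

theorem constantCoeff_weylG (L R : ℕ) : constantCoeff (weylG L R) = 1 := by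
  simp [weylG, constantCoeff_onePlusHalf, constantCoeff_oneMinusHalf, smul_eq_C_mul]
  norm_num

theorem two_mul_weylG (L R : ℕ) :
    2 * weylG L R = (onePlusHalf * oneMinusHalf⁻¹) ^ L + (oneMinusHalf * onePlusHalf⁻¹) ^ R := by
  rw [weylG, smul_eq_C_mul, smul_eq_C_mul]
  linear_combination ((onePlusHalf * oneMinusHalf⁻¹) ^ L +
    (oneMinusHalf * onePlusHalf⁻¹) ^ R) * C_half_add_C_half

/-- With `U = bQ` and `V = qB` one has `2g = U^L + V^R`, `UV = 1`, `U' = Q²` and `V' = -B²`. The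
cross terms match because `L + R = e + 1` forces `V^R Q^e = U^L V B^e`. -/
theorem derivative_weylG_mul (L R e : ℕ) (he : L + R = e + 1) :
    d⁄dX ℂ (weylG L R) *
        (onePlusHalf * oneMinusHalf⁻¹ ^ e + oneMinusHalf * onePlusHalf⁻¹ ^ e) =
      weylG L R * (L * oneMinusHalf⁻¹ ^ (e + 1) - R * onePlusHalf⁻¹ ^ (e + 1)) := by
  have hc := C_half_add_C_half
  have hb := onePlusHalf_mul_inv
  have hq := oneMinusHalf_mul_inv
  have hs := onePlusHalf_add_oneMinusHalf
  have h2 : (2 : ℂ⟦X⟧) ≠ 0 := by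
    intro h
    have h' := congrArg constantCoeff h
    rw [map_ofNat, map_zero] at h'
    norm_num at h'
  set b := onePlusHalf with hbdef
  set q := oneMinusHalf with hqdef
  set B := b⁻¹ with hB
  set Q := q⁻¹ with hQ
  have dB : d⁄dX ℂ B = -B ^ 2 * C (1 / 2) := by
    rw [hB, derivative_inv', hbdef, derivative_onePlusHalf]
  have dQ : d⁄dX ℂ Q = Q ^ 2 * C (1 / 2) := by
    rw [hQ, derivative_inv', hqdef, derivative_oneMinusHalf]
    ring
  have d1 : d⁄dX ℂ (b * Q) = Q ^ 2 := by
    rw [Derivation.leibniz, dQ, hbdef, derivative_onePlusHalf, smul_eq_mul, smul_eq_mul,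
      ← hbdef]
    linear_combination (Q ^ 2 * C (1 / 2)) * hs + Q ^ 2 * hc - Q * C (1 / 2) * hq
  have d2 : d⁄dX ℂ (q * B) = -B ^ 2 := by
    rw [Derivation.leibniz, dB, hqdef, derivative_oneMinusHalf, smul_eq_mul, smul_eq_mul,
      ← hqdef]
    linear_combination (-B ^ 2 * C (1 / 2)) * hs - B ^ 2 * hc + B * C (1 / 2) * hb
  have hu : (b * Q) * (q * B) = 1 := by linear_combination b * B * hq + hb
  have dG : 2 * d⁄dX ℂ (weylG L R) =
      L * (b * Q) ^ (L - 1) * Q ^ 2 - R * (q * B) ^ (R - 1) * B ^ 2 := by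
    have h := congrArg (d⁄dX ℂ) (two_mul_weylG L R)
    have h20 : d⁄dX ℂ (2 : ℂ⟦X⟧) = 0 := by
      rw [← map_ofNat (C (R := ℂ)) 2, derivative_C]
    rw [Derivation.leibniz, h20, map_add, Derivation.leibniz_pow, Derivation.leibniz_pow,
      d1, d2] at h
    simp only [smul_eq_mul, nsmul_eq_mul, mul_zero, add_zero] at h
    rw [h]
    ring
  have e1 : L * (b * Q) ^ (L - 1) = L * (b * Q) ^ L * (q * B) := by
    rcases L with _ | L
    · simp
    · rw [Nat.add_sub_cancel, pow_succ, mul_assoc _ _ (q * B), mul_assoc _ _ (q * B), hu, mul_one]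
  have e2 : R * (q * B) ^ (R - 1) = R * (q * B) ^ R * (b * Q) := by
    rcases R with _ | R
    · simp
    · rw [Nat.add_sub_cancel, pow_succ, mul_assoc _ _ (b * Q), mul_assoc _ _ (b * Q),
        mul_comm (q * B) (b * Q), hu, mul_one]
  have hQB : Q ^ e = (b * Q) ^ e * B ^ e := by
    rw [← mul_pow]; congr 1; linear_combination (-Q) * hb
  have hLR : (q * B) ^ R * (b * Q) ^ (e + 1) = (b * Q) ^ L := by
    rw [← he, pow_add, mul_comm, mul_assoc, ← mul_pow, hu, one_pow, mul_one]
  apply mul_left_cancel₀ h2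
  have hL : 2 * (d⁄dX ℂ (weylG L R) * (b * Q ^ e + q * B ^ e)) =
      (2 * d⁄dX ℂ (weylG L R)) * (b * Q ^ e + q * B ^ e) := by ring
  have hR : 2 * (weylG L R * (L * Q ^ (e + 1) - R * B ^ (e + 1))) =
      (2 * weylG L R) * (L * Q ^ (e + 1) - R * B ^ (e + 1)) := by ring
  rw [hL, hR, dG, two_mul_weylG, ← hbdef, ← hqdef, ← hQ, ← hB]
  rw [e1, e2]
  generalize hU : b * Q = U at *
  generalize hV : q * B = V at *
  have t1 : V * Q ^ 2 * b = Q := by rw [← hV]; linear_combination Q * B * b * hq + Q * hb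
  have t2 : V * Q ^ 2 * q = V * Q := by linear_combination V * Q * hq
  have t3 : U * B ^ 2 * q = B := by rw [← hU]; linear_combination Q * B * q * hb + B * hq
  have t4 : U * B ^ 2 * b = U * B := by linear_combination U * B * hb
  have t5 : V ^ R * Q ^ e = U ^ L * V * B ^ e := by
    rw [hQB, ← hLR, pow_succ]
    linear_combination (-V ^ R * U ^ e * B ^ e) * hu
  linear_combination L * U ^ L * Q ^ e * t1 + L * U ^ L * B ^ e * t2 - R * V ^ R * B ^ e * t3 -
    R * V ^ R * Q ^ e * t4 - L * Q * t5 - R * U * B * t5 - R * B ^ (e + 1) * U ^ L * hu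

/-! ### Compositional inverses, constant terms and commuting partial derivatives. -/

theorem existsUnique_isCompInverse {f : ℂ⟦X⟧} (h0 : constantCoeff f = 0)
    (h1 : IsUnit (coeff 1 f)) : ∃! h : ℂ⟦X⟧, IsCompInverse f h := by
  refine ⟨f.substInvOfIsUnit h1, ⟨h0, constantCoeff_substInvOfIsUnit f h1,
    subst_substInvOfIsUnit_right f h0 h1, subst_substInvOfIsUnit_left f h0 h1⟩, ?_⟩
  intro h hh
  have hs : HasSubst f := HasSubst.of_constantCoeff_zero' h0
  have hs' : HasSubst (f.substInvOfIsUnit h1) := HasSubst.substInvOfIsUnit f h1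
  have e1 : (subst (f.substInvOfIsUnit h1) (subst f h : ℂ⟦X⟧) : ℂ⟦X⟧) =
      f.substInvOfIsUnit h1 := by
    rw [hh.comp_left, subst_X hs']
  have e2 : (subst (f.substInvOfIsUnit h1) (subst f h : ℂ⟦X⟧) : ℂ⟦X⟧) = h := by
    rw [subst_comp_subst_apply hs hs', subst_substInvOfIsUnit_right f h0 h1, X_subst]
  rw [← e1, e2]

theorem constantCoeff_subst_of_constantCoeff_eq_zero {A B : Type*} [CommRing A] [CommRing B]
    [Algebra A B] {a : B⟦X⟧} (ha : constantCoeff a = 0) (f : A⟦X⟧) :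
    constantCoeff (subst a f : B⟦X⟧) = algebraMap A B (constantCoeff f) := by
  have hs : HasSubst a := HasSubst.of_constantCoeff_zero' ha
  rw [← coeff_zero_eq_constantCoeff_apply, coeff_subst' hs, finsum_eq_single _ 0]
  · simp [Algebra.algebraMap_eq_smul_one]
  · intro n hn
    simp [ha, hn]

/-- The commutator of two derivations is a derivation, and this one kills the variables. -/
theorem pderiv_comm {σ R : Type*} [CommRing R] (i j : σ) (p : MvPolynomial σ R) :
    MvPolynomial.pderiv i (MvPolynomial.pderiv j p) =
      MvPolynomial.pderiv j (MvPolynomial.pderiv i p) := by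
  classical
  have h : ⁅MvPolynomial.pderiv (R := R) i, MvPolynomial.pderiv (R := R) j⁆ = 0 := by
    apply MvPolynomial.derivation_ext
    intro k
    simp [Derivation.commutator_apply, MvPolynomial.pderiv_X, Pi.single_apply, apply_ite]
  have h' := congrArg
    (fun D : Derivation R (MvPolynomial σ R) (MvPolynomial σ R) => D p) h
  simpa [Derivation.commutator_apply, sub_eq_zero] using h'

/-! ### The classical form solves the evolution equation. -/

/-- The derivation `∂/∂α` of `ℂ[α, α*][[λ]]`. -/
def dAlpha : Derivation ℂ ClassicalPoly⟦X⟧ ClassicalPoly⟦X⟧ :=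
  coeffDerivation (MvPolynomial.pderiv Ladder.ann)

/-- The derivation `∂/∂α*` of `ℂ[α, α*][[λ]]`. -/
def dAlphaStar : Derivation ℂ ClassicalPoly⟦X⟧ ClassicalPoly⟦X⟧ :=
  coeffDerivation (MvPolynomial.pderiv Ladder.cre)

/-- The derivation `∂/∂λ` of `ℂ[α, α*][[λ]]`. -/
def dLambda : Derivation ℂ ClassicalPoly⟦X⟧ ClassicalPoly⟦X⟧ :=
  (d⁄dX ClassicalPoly).restrictScalars ℂ

theorem dLambda_apply (F : ClassicalPoly⟦X⟧) : dLambda F = d⁄dX ClassicalPoly F := rfl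

theorem dAlpha_dAlphaStar_comm (F : ClassicalPoly⟦X⟧) :
    dAlpha (dAlphaStar F) = dAlphaStar (dAlpha F) := by
  ext1 n
  simp only [dAlpha, dAlphaStar, coeff_coeffDerivation]
  exact pderiv_comm _ _ _

theorem constantCoeff_zArg (e : ℕ) : constantCoeff (zArg e) = 0 := by simp [zArg]

theorem dAlpha_zArg (e : ℕ) : dAlpha (zArg e) = 0 := by
  simp [zArg, dAlpha, Derivation.leibniz, coeffDerivation_C, coeffDerivation_X, alphaStar,
    Derivation.leibniz_pow, MvPolynomial.pderiv_X_of_ne]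

theorem dLambda_zArg (e : ℕ) : dLambda (zArg e) = C alphaStar ^ e := by
  simp [zArg, dLambda_apply, Derivation.leibniz]

/-- Euler's identity for degree `e` in `α*`; the factor `α*` avoids the exponent `e - 1`. -/
theorem mul_dAlphaStar_zArg (e : ℕ) : C alphaStar * dAlphaStar (zArg e) = e * zArg e := by
  have h : C alphaStar * dAlphaStar (zArg e) =
      C (alphaStar * MvPolynomial.pderiv Ladder.cre (alphaStar ^ e)) * X := by
    rw [zArg, dAlphaStar, Derivation.leibniz, coeffDerivation_C, coeffDerivation_X, map_mul]
    simp only [smul_eq_mul]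
    ring
  have h2 : alphaStar * MvPolynomial.pderiv Ladder.cre (alphaStar ^ e) = e * alphaStar ^ e := by
    rcases e with _ | e
    · simp
    · rw [Derivation.leibniz_pow, alphaStar, MvPolynomial.pderiv_X_self, Nat.add_sub_cancel,
        pow_succ, nsmul_eq_mul, smul_eq_mul]
      ring
  rw [h, h2, zArg, map_mul, map_natCast, mul_assoc]

theorem two_mul_algebraMap_half :
    2 * algebraMap ℂ ClassicalPoly⟦X⟧ (1 / 2) = 1 := by
  rw [← map_ofNat (algebraMap ℂ ClassicalPoly⟦X⟧) 2, ← map_mul]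
  norm_num

theorem constantCoeff_classicalForm (e : ℕ) {gbar fbar : ℂ⟦X⟧} (hg : constantCoeff gbar = 1)
    (hf : constantCoeff fbar = 0) : constantCoeff (classicalForm e gbar fbar) = 1 := by
  rw [classicalForm, map_mul,
    constantCoeff_subst_of_constantCoeff_eq_zero (constantCoeff_zArg e), hg,
    constantCoeff_subst_of_constantCoeff_eq_zero]
  · simp
  · rw [map_mul, constantCoeff_subst_of_constantCoeff_eq_zero (constantCoeff_zArg e), hf]
    simp

theorem dLambda_classicalForm {L R e : ℕ} (he : L + R = e + 1) {fbar : ℂ⟦X⟧}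
    (hf : IsCompInverse (weylF e) fbar) :
    d⁄dX ClassicalPoly (classicalForm e (subst fbar (weylG L R) : ℂ⟦X⟧)⁻¹ fbar) =
      creOp^[L] (annOp (creOp^[R]
        (classicalForm e (subst fbar (weylG L R) : ℂ⟦X⟧)⁻¹ fbar))) := by
  have hz := constantCoeff_zArg e
  have hsz : HasSubst (zArg e) := HasSubst.of_constantCoeff_zero' hz
  have hsf : HasSubst fbar := HasSubst.of_constantCoeff_zero' hf.constantCoeff_right
  set κ := algebraMap ℂ ClassicalPoly⟦X⟧ (1 / 2) with hκ
  have hcre : creOp = fun F => C alphaStar * F - κ * dAlpha F := by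
    funext F
    rw [creOp, Algebra.smul_def]
    rfl
  have hann : annOp = fun F => C alpha * F + κ * dAlphaStar F := by
    funext F
    rw [annOp, Algebra.smul_def]
    rfl
  rw [hcre, hann, ← dLambda_apply, classicalForm]
  set D : ClassicalPoly⟦X⟧ := subst (zArg e) fbar with hD
  set G : ClassicalPoly⟦X⟧ := subst (zArg e) (subst fbar (weylG L R) : ℂ⟦X⟧)⁻¹ with hG
  have hD0 : constantCoeff D = 0 := by
    rw [hD, constantCoeff_subst_of_constantCoeff_eq_zero hz, hf.constantCoeff_right, map_zero]
  have hsD : HasSubst D := HasSubst.of_constantCoeff_zero' hD0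
  -- `s` is evaluation at `D`. As an algebra map it carries the identities for `f` and `g` to
  -- identities in `D`, and `s (weylF e) = zArg e` because `fbar` inverts `f`.
  set s : ℂ⟦X⟧ →ₐ[ℂ] ClassicalPoly⟦X⟧ := substAlgHom hsD with hs
  have hs' (f : ℂ⟦X⟧) : s f = subst D f := by rw [hs, coe_substAlgHom]
  have hsX : s X = D := by rw [hs', subst_X hsD]
  have hsC (c : ℂ) : s (C c) = algebraMap ℂ _ c := s.commutes c
  have hsub (f : ℂ⟦X⟧) : s f = subst (zArg e) (subst fbar f : ℂ⟦X⟧) := by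
    rw [hs', subst_comp_subst_apply hsf hsz]
  have hsF : s (weylF e) = zArg e := by rw [hsub, hf.comp_right, subst_X hsz]
  have hchain (δ : Derivation ℂ ClassicalPoly⟦X⟧ ClassicalPoly⟦X⟧) (f : ℂ⟦X⟧) :
      δ (s f) = s (d⁄dX ℂ f) * δ D := by
    rw [hs', hs', derivation_subst δ hD0]
  -- Implicit differentiation of `f(D) = z`; it determines the derivatives of `D`, since `f'(D)` has
  -- constant term `1`.
  have hFchain (δ : Derivation ℂ ClassicalPoly⟦X⟧ ClassicalPoly⟦X⟧) :
      s (d⁄dX ℂ (weylF e)) * δ D = δ (zArg e) := by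
    rw [← hchain, hsF]
  have hsq : s oneMinusHalf = 1 - κ * D := by
    rw [oneMinusHalf_eq, map_sub, map_mul, map_one, hsC, hsX]
  have hsb : s onePlusHalf = 1 + κ * D := by
    rw [onePlusHalf_eq, map_add, map_mul, map_one, hsC, hsX]
  have hGg : s (weylG L R) * G = 1 := by
    rw [hsub, hG, ← subst_mul hsz, PowerSeries.mul_inv_cancel, ← coe_substAlgHom hsz, map_one]
    rw [constantCoeff_subst_of_constantCoeff_eq_zero hf.constantCoeff_right, constantCoeff_weylG]
    simp
  have hGd (δ : Derivation ℂ ClassicalPoly⟦X⟧ ClassicalPoly⟦X⟧) :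
      δ G = -G ^ 2 * s (d⁄dX ℂ (weylG L R)) * δ D := by
    have h := congrArg δ hGg
    rw [Derivation.leibniz, hchain, Derivation.map_one_eq_zero, smul_eq_mul, smul_eq_mul] at h
    linear_combination G * h - δ G * hGg
  have hE0 : constantCoeff (C (alphaStar * alpha) * D) = 0 := by rw [map_mul, hD0, mul_zero]
  have hEd (δ : Derivation ℂ ClassicalPoly⟦X⟧ ClassicalPoly⟦X⟧) :
      δ (subst (C (alphaStar * alpha) * D) (PowerSeries.exp ℂ) : ClassicalPoly⟦X⟧) =
        δ (C alphaStar * C alpha * D) *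
          (subst (C (alphaStar * alpha) * D) (PowerSeries.exp ℂ) : ClassicalPoly⟦X⟧) := by
    rw [derivation_subst δ hE0, derivative_exp, mul_comm, map_mul C]
  have hF1 : s (d⁄dX ℂ (weylF e)) ≠ 0 := by
    intro h
    have h' := congrArg constantCoeff h
    rw [hs', constantCoeff_subst_of_constantCoeff_eq_zero hD0,
      ← coeff_zero_eq_constantCoeff_apply, coeff_derivative, zero_add, coeff_one_weylF] at h'
    simp at h'
  have hy0 : (C alphaStar : ClassicalPoly⟦X⟧) ≠ 0 := by
    intro h
    have h' := congrArg constantCoeff h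
    rw [constantCoeff_C, map_zero] at h'
    exact MvPolynomial.X_ne_zero _ h'
  refine evolution_of_functional_equations he (f₀ := s (weylF e))
    (f₁ := s (d⁄dX ℂ (weylF e))) (g₀ := s (weylG L R)) (g₁ := s (d⁄dX ℂ (weylG L R)))
    (Q := s oneMinusHalf⁻¹) (B := s onePlusHalf⁻¹) (α := C alpha) (D := D)
    dAlpha_dAlphaStar_comm ?_ ?_ (Derivation.map_algebraMap _ _) ?_ ?_ ?_
    (Derivation.map_algebraMap _ _) ?_ ?_ two_mul_algebraMap_half hy0 hF1 ?_ ?_ ?_ ?_ ?_ ?_ ?_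
    hGg (hGd _) (hGd _) (hGd _) (hEd _) (hEd _) (hEd _)
  · simp [dAlpha, coeffDerivation_C, alphaStar, MvPolynomial.pderiv_X_of_ne]
  · simp [dAlpha, coeffDerivation_C, alpha]
  · rw [hD, derivation_subst _ hz, dAlpha_zArg, mul_zero]
  · simp [dAlphaStar, coeffDerivation_C, alphaStar]
  · simp [dAlphaStar, coeffDerivation_C, alpha, MvPolynomial.pderiv_X_of_ne]
  · rw [dLambda_apply, derivative_C]
  · rw [dLambda_apply, derivative_C]
  · rw [hFchain, dLambda_zArg]
  · rw [hFchain, mul_dAlphaStar_zArg, hsF]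
  · rw [← hsq, ← map_mul, oneMinusHalf_mul_inv, map_one]
  · rw [← hsb, ← map_mul, onePlusHalf_mul_inv, map_one]
  · have h := congrArg s (two_mul_derivative_weylF e)
    simpa only [map_mul, map_add, map_pow, map_ofNat] using h
  · have h := congrArg s (natCast_mul_weylF e)
    simpa only [map_mul, map_sub, map_pow, map_natCast] using h
  · have h := congrArg s (derivative_weylG_mul L R e he)
    simpa only [map_mul, map_sub, map_add, map_pow, map_natCast, hsq, hsb] using h

/-- The chain rule for `f(h(z)) = z`, evaluated at `z = 0`. -/
theorem IsCompInverse.coeff_one_mul {f h : ℂ⟦X⟧} (H : IsCompInverse f h) :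
    coeff 1 f * coeff 1 h = 1 := by
  have e := congrArg (fun F : ℂ⟦X⟧ => constantCoeff (d⁄dX ℂ F)) H.comp_right
  simp only [derivation_subst (d⁄dX ℂ) H.constantCoeff_right, map_mul, derivative_X, map_one,
    constantCoeff_subst_of_constantCoeff_eq_zero H.constantCoeff_right] at e
  rw [← coeff_zero_eq_constantCoeff_apply, ← coeff_zero_eq_constantCoeff_apply,
    coeff_derivative, coeff_derivative] at e
  simpa using e

end WeylOrdering

end

/-- A natural number `e` with `L + R = e + 1` encodes `e = L + R - 1 ≥ 0` without truncated
subtraction. -/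
theorem mainTheorem3 (L R e : ℕ) (he : L + R = e + 1) :
    (∃! fbar : PowerSeries ℂ, WeylOrdering.IsCompInverse (WeylOrdering.weylF e) fbar) ∧
    ∀ fbar gbar : PowerSeries ℂ,
      WeylOrdering.IsCompInverse (WeylOrdering.weylF e) fbar →
      gbar = (PowerSeries.subst fbar (WeylOrdering.weylG L R) : PowerSeries ℂ)⁻¹ →
      PowerSeries.coeff 0 fbar = 0 ∧ PowerSeries.coeff 1 fbar = 1 ∧
      PowerSeries.coeff 0 gbar = 1 ∧
      WeylOrdering.expLambda
          (WeylOrdering.cre ^ L * WeylOrdering.ann * WeylOrdering.cre ^ R) =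
        WeylOrdering.weylQuantSeries (WeylOrdering.classicalForm e gbar fbar) := by
  refine ⟨WeylOrdering.existsUnique_isCompInverse (WeylOrdering.constantCoeff_weylF e)
    (by rw [WeylOrdering.coeff_one_weylF]; exact isUnit_one), ?_⟩
  rintro fbar gbar hf rfl
  have hg : PowerSeries.constantCoeff
      (PowerSeries.subst fbar (WeylOrdering.weylG L R) : PowerSeries ℂ)⁻¹ = 1 := by
    rw [PowerSeries.constantCoeff_inv,
      WeylOrdering.constantCoeff_subst_of_constantCoeff_eq_zero hf.constantCoeff_right,
      WeylOrdering.constantCoeff_weylG, map_one, inv_one]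
  refine ⟨?_, ?_, ?_, ?_⟩
  · rw [PowerSeries.coeff_zero_eq_constantCoeff_apply, hf.constantCoeff_right]
  · simpa [WeylOrdering.coeff_one_weylF] using hf.coeff_one_mul
  · rw [PowerSeries.coeff_zero_eq_constantCoeff_apply, hg]
  · exact WeylOrdering.expLambda_eq_weylQuantSeries L R _
      (WeylOrdering.constantCoeff_classicalForm e hg hf.constantCoeff_right)
      (WeylOrdering.dLambda_classicalForm he hf)
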